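/- Let $n\ge 1$. An $n\times n$ complex matrix $H=(h_{ij})$ is a Hankel matrix if $h_{ij}=h_{i'j'}$ whenever $i+j=i'+j'$; let $\operatorname{Hank}_n(\mathbb{C})\subseteq\mathbb{C}^{n\times n}$ be the linear subspace of Hankel matrices and $\operatorname{Hank}_n^r(\mathbb{C})$ the set of $r$-tuples of Hankel matrices, regarded as a linear subvariety of affine space $\mathbb{C}^{rn^2}$. Let $$\rho_r:\operatorname{Hank}_n^r(\mathbb{C})\to\mathbb{C}^{n\times n},\qquad \rho_r(H_1,\dots,H_r)=H_1\cdots H_r .$$ If $r\ge\lfloor n/2\rfloor+1$, then $\rho_r$ is a dominant morphism, i.e. it is given by polynomials in the matrix entries and its image is Zariski dense in $\mathbb{C}^{n\times n}\simeq\mathbb{C}^{n^2}$. Moreover, for $r=\lfloor n/2\rfloor+1$, a generic $A\in\mathbb{C}^{n\times n}$ is a product $A=H_1\cdots H_r$ of $r$ Hankel matrices, i.e. the Zariski closure of the set of matrices that are not such a product is a proper subset of $\mathbb{C}^{n\times n}$. -/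

import Mathlib

open MvPolynomial

/-- The Zariski topology on affine space `ℂ^σ`: the closed sets are the algebraic sets, i.e. the
zero loci of ideals of `ℂ[x_s : s ∈ σ]`. -/
@[reducible] def zariskiTopology (σ : Type) : TopologicalSpace (σ → ℂ) :=
  TopologicalSpace.ofClosed {Z | ∃ I : Ideal (MvPolynomial σ ℂ), Z = zeroLocus ℂ I}
    ⟨⊤, by rw [zeroLocus_top]; rfl⟩
    (by
      intro A hA
      refine ⟨sSup {I | zeroLocus ℂ I ∈ A}, ?_⟩
      apply Set.Subset.antisymm
      · intro x hx
        have h : sSup {I | zeroLocus ℂ I ∈ A} ≤ vanishingIdeal ℂ {x} := by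
          refine sSup_le fun I hI => ?_
          intro p hp
          rw [mem_vanishingIdeal_singleton_iff]
          exact hx _ hI p hp
        intro p hp
        exact (mem_vanishingIdeal_singleton_iff x p).1 (h hp)
      · intro x hx Z hZ
        obtain ⟨I, rfl⟩ := hA hZ
        intro p hp
        exact hx p ((le_sSup hZ : I ≤ _) hp))
    (by
      rintro _ ⟨I, rfl⟩ _ ⟨J, rfl⟩
      refine ⟨I * J, ?_⟩
      apply Set.Subset.antisymm
      · rintro x (hx | hx)
        · exact zeroLocus_anti_mono (Ideal.mul_le_left : I * J ≤ I) hx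
        · exact zeroLocus_anti_mono (Ideal.mul_le_right : I * J ≤ J) hx
      · intro x hx
        by_contra hcon
        simp only [Set.mem_union, mem_zeroLocus_iff, not_or, not_forall] at hcon
        obtain ⟨⟨p, hp, hpx⟩, q, hq, hqx⟩ := hcon
        have h := hx (p * q) (Ideal.mul_mem_mul hp hq)
        rw [map_mul] at h
        exact (mul_ne_zero hpx hqx) h)

/-- The Zariski (subspace) topology on a set `X` placed in affine space `ℂ^σ` by coordinates
`c : X → ℂ^σ`. -/
@[reducible] def zariskiOn {X σ : Type} (c : X → σ → ℂ) : TopologicalSpace X :=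
  TopologicalSpace.induced c (zariskiTopology σ)

/-- `f : X → Y` is a morphism for the coordinates `cX` on `X` and `cY` on `Y`: every coordinate of
`f x` is given by a polynomial in the coordinates of `x`. -/
def IsMorphism {X Y σ τ : Type} (cX : X → σ → ℂ) (cY : Y → τ → ℂ) (f : X → Y) : Prop :=
  ∃ P : τ → MvPolynomial σ ℂ, ∀ (x : X) (t : τ), cY (f x) t = eval (cX x) (P t)

/-- A dominant morphism: a morphism whose image is Zariski dense in the target. -/
def IsDominantMorphism {X Y σ τ : Type} (cX : X → σ → ℂ) (cY : Y → τ → ℂ) (f : X → Y) : Prop :=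
  IsMorphism cX cY f ∧ @closure Y (zariskiOn cY) (Set.range f) = Set.univ

/-- The property `P` holds for a generic point of `X`: the Zariski closure of the set of points
where `P` fails is a proper closed subset of `X`. -/
def HoldsGenerically {X σ : Type} (c : X → σ → ℂ) (P : X → Prop) : Prop :=
  @closure X (zariskiOn c) {x | ¬ P x} ≠ Set.univ

/-- The linear space of `n × n` complex Hankel matrices: `H i j` depends only on `i + j`, the sum
being taken in `ℕ`. -/
def Hank (n : ℕ) : Submodule ℂ (Matrix (Fin n) (Fin n) ℂ) where
  carrier := {H | ∀ i j i' j' : Fin n, (i : ℕ) + (j : ℕ) = (i' : ℕ) + (j' : ℕ) → H i j = H i' j'}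
  add_mem' := by
    intro A B hA hB i j i' j' h
    simp only [Matrix.add_apply, hA i j i' j' h, hB i j i' j' h]
  zero_mem' := by
    intro i j i' j' _
    rfl
  smul_mem' := by
    intro a A hA i j i' j' h
    simp only [Matrix.smul_apply, hA i j i' j' h]

/-- The entries of an `n × n` matrix, as a point of affine space `ℂ^(n²)`. -/
def matrixCoords (n : ℕ) (A : Matrix (Fin n) (Fin n) ℂ) : Fin n × Fin n → ℂ :=
  fun p => A p.1 p.2

/-- The entries of an `r`-tuple of Hankel matrices, as a point of affine space `ℂ^(r n²)`. -/
def hankTupleCoords (n r : ℕ) (H : Fin r → Hank n) : Fin r × Fin n × Fin n → ℂ :=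
  fun p => (H p.1 : Matrix (Fin n) (Fin n) ℂ) p.2.1 p.2.2

/-- The product map `(H₁, …, H_r) ↦ H₁ ⋯ H_r`, in this order. -/
def hankProd (n r : ℕ) (H : Fin r → Hank n) : Matrix (Fin n) (Fin n) ℂ :=
  (List.ofFn fun k => (H k : Matrix (Fin n) (Fin n) ℂ)).prod

/-!
Let `Toep` be the space of Toeplitz matrices and `J` the flip matrix. Since `T J` is Hankel and
`J T J` is Toeplitz for each Toeplitz `T`, every product `T₁ ⋯ T_r J ^ r` is a product of `r` Hankel
matrices, so it suffices to study products of Toeplitz matrices, where the identity is available as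
a factor.

Let `s = ⌊n / 2⌋`. The products of `s + 1` Toeplitz matrices have an interior point as soon as there
are `E₁, …, E_s ∈ Toep` with `Toep + ∑ E_i Toep` equal to the space of all matrices
(`exists_pow_mem_nhds_of_hasStrictFDerivAt`). The derivative of the product map is surjective at
`(1 + ε₁ E₁, …, 1 + ε_s E_s, 1)` for a suitable choice of nonzero `ε_i`, made one after the other:
two neighbouring factors `1 + ε E` and `1` contribute the directions `z` and `(1 + ε E) z`, hence
`E z`, and the remaining directions change by a multiple of `ε`, which preserves surjectivity for
some `ε ≠ 0`.

Such `E_i` exist (`exists_sub_sum_toepGen_mul_mem_toep`). A matrix is Toeplitz if and only if its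
displacement `A (k + 1) (l + 1) - A k l`, an `(n - 1) × (n - 1)` matrix, vanishes, and the
displacement of a product `E X` of Toeplitz matrices is a sum of two matrices of rank one, a column
of `E` times a row of `X` each. The two columns coming from `E` can be any two vectors and the two
rows coming from `X` are arbitrary, so `s ≥ (n - 1) / 2` matrices `E_i` reach every displacement.

A polynomial vanishing on a set with an interior point is zero, which gives dominance. For the
generic statement, the comorphism of the product map is injective by dominance. Chevalley's theorem
then gives a nonzero `g` whose nonvanishing locus lies in the image on prime spectra, and by the
Nullstellensatz its closed points are images of points
(`exists_ne_zero_forall_eval_ne_zero_exists_eq`).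
-/

/-! ### Products of elements of a subspace of an algebra -/

section ProductsOfElements

open Filter Topology
open scoped Pointwise RightActions

/-- A surjection onto a finite-dimensional space stays surjective after adding a suitable nonzero
multiple of a given map: if `σ` is a right inverse of `Φ`, then `(Φ + ε Ψ) σ = 1 + ε Ψ σ` is
invertible unless `-ε⁻¹` is one of the finitely many eigenvalues of `Ψ σ`. -/
theorem LinearMap.exists_ne_zero_surjective_add_smul {K D A : Type*} [Field K] [Infinite K]
    [AddCommGroup D] [Module K D] [AddCommGroup A] [Module K A] [FiniteDimensional K A]
    (Φ Ψ : D →ₗ[K] A) (hΦ : Function.Surjective Φ) :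
    ∃ ε : K, ε ≠ 0 ∧ Function.Surjective (Φ + ε • Ψ) := by
  obtain ⟨σ, hσ⟩ := Φ.exists_rightInverse_of_surjective (LinearMap.range_eq_top.2 hΦ)
  obtain ⟨μ, hμ⟩ :=
    ((Module.End.finite_spectrum (Ψ ∘ₗ σ)).union (Set.finite_singleton 0)).infinite_compl.nonempty
  simp only [Set.mem_compl_iff, Set.mem_union, Set.mem_singleton_iff, not_or] at hμ
  obtain ⟨hμ, hμ0⟩ := hμ
  rw [spectrum.notMem_iff, Module.End.isUnit_iff] at hμ
  refine ⟨-μ⁻¹, by simpa using hμ0, fun y => ?_⟩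
  obtain ⟨z, hz⟩ := hμ.2 (μ • y)
  refine ⟨σ z, ?_⟩
  have h1 : Φ (σ z) = z := LinearMap.congr_fun hσ z
  have h2 : μ • z - Ψ (σ z) = μ • y := by simpa [Module.algebraMap_end_apply] using hz
  have h3 := congrArg (fun w => μ⁻¹ • w) h2
  simp only [smul_sub, smul_smul, inv_mul_cancel₀ hμ0, one_smul] at h3
  simp [h1, ← h3, sub_eq_add_neg]

variable {𝕜 : Type*} [NontriviallyNormedField 𝕜] {A : Type} [NormedRing A] [NormedAlgebra 𝕜 A]

theorem HasStrictFDerivAt.mul_coe_submodule (V : Submodule 𝕜 A) {U : Type*}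
    [NormedAddCommGroup U] [NormedSpace 𝕜 U] {g : U → A} {u₀ : U} {L : U →L[𝕜] A}
    (hL : HasStrictFDerivAt g L u₀) (w₀ : V) :
    HasStrictFDerivAt (fun p : U × V => g p.1 * (p.2 : A))
      (g u₀ • (V.subtypeL.comp (.snd 𝕜 U V)) + (L.comp (.fst 𝕜 U V)) <• (w₀ : A)) (u₀, w₀) :=
  HasStrictFDerivAt.mul' (x := (u₀, w₀)) (hL.comp (u₀, w₀) hasStrictFDerivAt_fst)
    (V.subtypeL.comp (.snd 𝕜 U V)).hasStrictFDerivAt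

variable [CompleteSpace 𝕜] [FiniteDimensional 𝕜 A]

/-- The inductive form of `exists_forall_infinite_add_smul_mem_pow`: the parametrized family `g` of
products of `k` elements of `V` is extended by one factor `1 + ε E` for each `E` in the list `l`,
and by a last factor `1`. The hypothesis `hsurj` says that the tangent directions `L u` and
`g u₀ * w` of `g` times a factor near `1` span everything together with `g u₀ * (∑ E V)`. -/
theorem exists_pow_mem_nhds_of_hasStrictFDerivAt (V : Submodule 𝕜 A) (h1 : (1 : A) ∈ V)
    (l : List A) (hl : ∀ E ∈ l, E ∈ V) {U : Type} [NormedAddCommGroup U] [NormedSpace 𝕜 U]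
    [FiniteDimensional 𝕜 U] (k : ℕ) (g : U → A) (hg : ∀ u, g u ∈ (V : Set A) ^ k) (u₀ : U)
    (L : U →L[𝕜] A) (hL : HasStrictFDerivAt g L u₀)
    (hsurj : ∀ M : A, ∃ u : U, ∃ w ∈ V, ∃ ρ ∈ Submodule.span 𝕜 {E | E ∈ l} * V,
      L u + g u₀ * (w + ρ) = M) :
    ∃ a : A, (V : Set A) ^ (k + l.length + 1) ∈ 𝓝 a := by
  induction l generalizing U k with
  | nil =>
    have hgV : ∀ p : U × V, g p.1 * (p.2 : A) ∈ (V : Set A) ^ (k + 1) := fun p => by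
      rw [pow_succ]
      exact Set.mul_mem_mul (hg p.1) p.2.2
    refine ⟨g u₀ * (1 : A), ?_⟩
    have hd := hL.mul_coe_submodule V ⟨1, h1⟩
    have : CompleteSpace (U × V) := FiniteDimensional.complete 𝕜 _
    have : CompleteSpace A := FiniteDimensional.complete 𝕜 _
    have := hd.map_nhds_eq_of_surj (LinearMap.range_eq_top.2 fun M => by
      obtain ⟨u, w, hw, ρ, hρ, h⟩ := hsurj M
      have hρ : ρ = 0 := by simpa using hρ
      exact ⟨(u, ⟨w, hw⟩), by simp [← h, hρ, add_comm]⟩)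
    rw [← this]
    exact mem_map.2 (univ_mem' hgV)
  | cons E l ih =>
    have hgV : ∀ p : U × V, g p.1 * (p.2 : A) ∈ (V : Set A) ^ (k + 1) := fun p => by
      rw [pow_succ]
      exact Set.mul_mem_mul (hg p.1) p.2.2
    set R := Submodule.span 𝕜 {E | E ∈ l} * V with hR
    -- `Φ` collects the directions available for `ε = 0`, and `Φ + ε Ψ` those available after the
    -- factor `1 + ε E` has been inserted
    let Φ : U × V × V × R →ₗ[𝕜] A :=
      L.toLinearMap.coprod ((LinearMap.mulLeft 𝕜 (g u₀) ∘ₗ V.subtype).coprod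
        ((LinearMap.mulLeft 𝕜 (g u₀ * E) ∘ₗ V.subtype).coprod
          (LinearMap.mulLeft 𝕜 (g u₀) ∘ₗ R.subtype)))
    let Ψ : U × V × V × R →ₗ[𝕜] A :=
      (LinearMap.mulRight 𝕜 E ∘ₗ L.toLinearMap).coprod ((0 : V →ₗ[𝕜] A).coprod
        ((0 : V →ₗ[𝕜] A).coprod (LinearMap.mulLeft 𝕜 (g u₀ * E) ∘ₗ R.subtype)))
    have hΦ : Function.Surjective Φ := fun M => by
      obtain ⟨u, w, hw, ρ, hρ, h⟩ := hsurj M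
      have hset : {E' | E' ∈ E :: l} = insert E {E' | E' ∈ l} := by ext; simp
      rw [hset, Submodule.span_insert, Submodule.sup_mul, Submodule.mem_sup] at hρ
      obtain ⟨y, hy, ρ', hρ', rfl⟩ := hρ
      obtain ⟨z, hz, rfl⟩ := Submodule.mem_span_singleton_mul.1 hy
      exact ⟨(u, ⟨w, hw⟩, ⟨z, hz⟩, ⟨ρ', hρ'⟩), by simp [Φ, ← h, mul_add]⟩
    obtain ⟨ε, hε, hs⟩ := Φ.exists_ne_zero_surjective_add_smul Ψ hΦ
    have hE : 1 + ε • E ∈ V := V.add_mem h1 (V.smul_mem ε (hl E (by simp)))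
    have := ih (fun E' hE' => hl E' (by simp [hE'])) (k + 1) (fun p : U × V => g p.1 * (p.2 : A))
      hgV (u₀, ⟨1 + ε • E, hE⟩) _ (hL.mul_coe_submodule V _) (fun M => by
        obtain ⟨⟨u, w, z, ρ⟩, h⟩ := hs M
        -- `E z` is the difference quotient `ε⁻¹ ((1 + ε E) z - z)`
        refine ⟨(u, w - ε⁻¹ • z), ε⁻¹ • z, V.smul_mem _ z.2, ρ, ρ.2, ?_⟩
        rw [← h]
        simp only [Φ, Ψ, add_apply, LinearMap.add_apply, LinearMap.smul_apply,
          LinearMap.coprod_apply]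
        simp [mul_add, add_mul, mul_assoc, mul_sub, hε]
        abel)
    simpa [add_assoc, add_comm, add_left_comm] using this

/-- If `V` contains `1` and `A = V + E₁ V + ⋯ + E_s V` for some `E_i ∈ V`, then the set of products
of `s + 1` elements of `V` has an interior point `a`. The conclusion records only that it contains
infinitely many points of each line through `a`, which does not mention the norm of `A`. -/
theorem exists_forall_infinite_add_smul_mem_pow (V : Submodule 𝕜 A) (h1 : (1 : A) ∈ V) {s : ℕ}
    (E : Fin s → A) (hE : ∀ i, E i ∈ V)
    (hspan : ∀ M : A, ∃ X : Fin s → A, (∀ i, X i ∈ V) ∧ M - ∑ i, E i * X i ∈ V) :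
    ∃ a : A, ∀ b : A, {t : 𝕜 | a + t • b ∈ (V : Set A) ^ (s + 1)}.Infinite := by
  obtain ⟨a, ha⟩ := exists_pow_mem_nhds_of_hasStrictFDerivAt V h1 (List.ofFn E)
    (by simpa [List.mem_ofFn] using hE) (U := PUnit) 0 (fun _ => 1) (fun _ => by simp)
    PUnit.unit (0 : PUnit →L[𝕜] A) (hasStrictFDerivAt_const _ _) (fun M => by
      obtain ⟨X, hX, h⟩ := hspan M
      refine ⟨PUnit.unit, _, h, ∑ i, E i * X i, ?_, by simp⟩
      exact Submodule.sum_mem _ fun i _ =>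
        Submodule.mul_mem_mul (Submodule.subset_span (by simp [List.mem_ofFn])) (hX i))
  rw [List.length_ofFn, zero_add] at ha
  refine ⟨a, fun b => infinite_of_mem_nhds (0 : 𝕜) ?_⟩
  have hc : Continuous fun t : 𝕜 => a + t • b := by fun_prop
  exact hc.continuousAt (by simpa using ha)

end ProductsOfElements

/-! ### Toeplitz matrices and Hankel matrices -/

section ToeplitzHankel

open scoped Pointwise

/-- The linear space of `n × n` complex Toeplitz matrices: `T i j` depends only on `i - j`. The
equality `i - j = i' - j'` is written as `i + j' = i' + j` in `ℕ`. -/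
def Toep (n : ℕ) : Submodule ℂ (Matrix (Fin n) (Fin n) ℂ) where
  carrier := {T | ∀ i j i' j' : Fin n, (i : ℕ) + (j' : ℕ) = (i' : ℕ) + (j : ℕ) → T i j = T i' j'}
  add_mem' := by
    intro A B hA hB i j i' j' h
    simp only [Matrix.add_apply, hA i j i' j' h, hB i j i' j' h]
  zero_mem' := by
    intro i j i' j' _
    rfl
  smul_mem' := by
    intro a A hA i j i' j' h
    simp only [Matrix.smul_apply, hA i j i' j' h]

theorem one_mem_toep (n : ℕ) : (1 : Matrix (Fin n) (Fin n) ℂ) ∈ Toep n := by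
  intro i j i' j' h
  simp only [Matrix.one_apply, Fin.ext_iff]
  congr 1
  apply propext
  omega

theorem of_sub_mem_toep {n : ℕ} (f : ℤ → ℂ) :
    Matrix.of (fun i j : Fin n => f ((i : ℤ) - (j : ℤ))) ∈ Toep n := by
  intro i j i' j' h
  simp only [Matrix.of_apply]
  congr 1
  omega

/-- A matrix is Toeplitz as soon as it is invariant under a unit shift along the diagonals. -/
theorem mem_toep_of_succ_eq_castSucc {m : ℕ} {T : Matrix (Fin (m + 1)) (Fin (m + 1)) ℂ}
    (h : ∀ k l : Fin m, T k.succ l.succ = T k.castSucc l.castSucc) : T ∈ Toep (m + 1) := by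
  have key : ∀ d i j : ℕ, ∀ (hi : i + d < m + 1) (hj : j + d < m + 1),
      T ⟨i + d, hi⟩ ⟨j + d, hj⟩ = T ⟨i, by omega⟩ ⟨j, by omega⟩ := by
    intro d
    induction d with
    | zero => intros; rfl
    | succ d ih =>
      intro i j hi hj
      rw [← ih i j (by omega) (by omega)]
      exact h ⟨i + d, by omega⟩ ⟨j + d, by omega⟩
  intro i j i' j' hij
  rcases le_total (i : ℕ) i' with hle | hle
  · have := key (i' - i) i j (by omega) (by omega)
    rw [← this]
    congr 1 <;> ext <;> simp <;> omega
  · have := key (i - i') i' j' (by omega) (by omega)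
    rw [← this]
    congr 1 <;> ext <;> simp <;> omega

/-- The displacement `T (k + 1) (l + 1) - T k l` of a product of two Toeplitz matrices has rank at
most two. -/
theorem mul_succ_sub_mul_castSucc_of_mem_toep {m : ℕ}
    {S T : Matrix (Fin (m + 1)) (Fin (m + 1)) ℂ} (hS : S ∈ Toep (m + 1)) (hT : T ∈ Toep (m + 1))
    (k l : Fin m) :
    (S * T) k.succ l.succ - (S * T) k.castSucc l.castSucc =
      S k.succ 0 * T 0 l.succ - S k.castSucc (Fin.last m) * T (Fin.last m) l.castSucc := by
  rw [Matrix.mul_apply, Matrix.mul_apply, Fin.sum_univ_succ, Fin.sum_univ_castSucc]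
  have : ∀ i : Fin m, S k.succ i.succ * T i.succ l.succ =
      S k.castSucc i.castSucc * T i.castSucc l.castSucc := fun i => by
    rw [hS k.succ i.succ k.castSucc i.castSucc (by simp; omega),
      hT i.succ l.succ i.castSucc l.castSucc (by simp; omega)]
  simp only [this]
  ring

/-- The Toeplitz matrix `E_i` (`i < s`) with `1` on the diagonal of offset `i + 1` and `-1` on the
diagonal of offset `s + i - m`, where `s = (m + 1) / 2`. The first column below the diagonal is the
basis vector `e_i`, and the last column above the diagonal is `-e_{s + i}`, or zero if
`s + i = m`. -/
def toepGen (m : ℕ) (i : Fin ((m + 1) / 2)) : Matrix (Fin (m + 1)) (Fin (m + 1)) ℂ :=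
  Matrix.of fun k l => if (k : ℤ) - (l : ℤ) = i + 1 then 1 else
    if (k : ℤ) - (l : ℤ) = ((m + 1) / 2 : ℕ) + i - m then -1 else 0

theorem toepGen_mem_toep (m : ℕ) (i : Fin ((m + 1) / 2)) : toepGen m i ∈ Toep (m + 1) :=
  of_sub_mem_toep fun d : ℤ => if d = i + 1 then 1 else
    if d = ((m + 1) / 2 : ℕ) + i - m then -1 else 0

/-- The space of matrices is `Toep + ∑ E_i Toep`: the displacements of the products `E_i X_i` are
`e_i ⊗ (first row of X_i) + e_{s + i} ⊗ (last row of X_i)`, and outside the diagonal the first and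
last rows of a Toeplitz matrix are arbitrary. -/
theorem exists_sub_sum_toepGen_mul_mem_toep (m : ℕ) (M : Matrix (Fin (m + 1)) (Fin (m + 1)) ℂ) :
    ∃ X : Fin ((m + 1) / 2) → Matrix (Fin (m + 1)) (Fin (m + 1)) ℂ,
      (∀ i, X i ∈ Toep (m + 1)) ∧ M - ∑ i, toepGen m i * X i ∈ Toep (m + 1) := by
  set s := (m + 1) / 2 with hs
  let D : ℕ → ℕ → ℂ := fun k l => if h : k < m ∧ l < m then
    M (Fin.succ ⟨k, h.1⟩) (Fin.succ ⟨l, h.2⟩) - M (Fin.castSucc ⟨k, h.1⟩) (Fin.castSucc ⟨l, h.2⟩)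
    else 0
  let x : Fin s → ℤ → ℂ := fun i d =>
    if d < 0 then D i (-d - 1).toNat else D (s + i) (m - d).toNat
  let X : Fin s → Matrix (Fin (m + 1)) (Fin (m + 1)) ℂ := fun i =>
    Matrix.of fun k l => x i ((k : ℤ) - (l : ℤ))
  have hX : ∀ i, X i ∈ Toep (m + 1) := fun i => of_sub_mem_toep _
  refine ⟨X, hX, mem_toep_of_succ_eq_castSucc fun k l => ?_⟩
  have hk := k.2
  have hl := l.2
  have hfirst : ∀ i, X i 0 l.succ = D i l := fun i => by
    have h1 : (0 : ℤ) - ((l : ℤ) + 1) < 0 := by omega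
    have h2 : (-((0 : ℤ) - ((l : ℤ) + 1)) - 1).toNat = l := by omega
    simp only [X, x, Matrix.of_apply, Fin.val_zero, Fin.val_succ, Nat.cast_zero, Nat.cast_add,
      Nat.cast_one, if_pos h1, h2]
  have hlast : ∀ i, X i (Fin.last m) l.castSucc = D (s + i) l := fun i => by
    have h1 : ¬ ((m : ℤ) - (l : ℤ) < 0) := by omega
    have h2 : ((m : ℤ) - ((m : ℤ) - (l : ℤ))).toNat = l := by omega
    simp only [X, x, Matrix.of_apply, Fin.val_last, Fin.val_castSucc, if_neg h1, h2]
  have hcol : ∀ i : Fin s, toepGen m i k.succ 0 = if (k : ℕ) = i then 1 else 0 := fun i => by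
    have hi := i.2
    simp only [toepGen, Matrix.of_apply, Fin.val_zero, Fin.val_succ, Nat.cast_zero, Nat.cast_add,
      Nat.cast_one]
    split_ifs <;> first | rfl | omega
  have hcol' : ∀ i : Fin s, toepGen m i k.castSucc (Fin.last m) =
      if (k : ℕ) = s + i then -1 else 0 := fun i => by
    have hi := i.2
    simp only [toepGen, Matrix.of_apply, Fin.val_last, Fin.val_castSucc]
    split_ifs <;> first | rfl | omega
  have hsum : (∑ i, toepGen m i * X i) k.succ l.succ -
      (∑ i, toepGen m i * X i) k.castSucc l.castSucc = D k l := by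
    simp only [Matrix.sum_apply, ← Finset.sum_sub_distrib,
      mul_succ_sub_mul_castSucc_of_mem_toep (toepGen_mem_toep m _) (hX _), hfirst, hlast, hcol,
      hcol']
    by_cases hks : (k : ℕ) < s
    · rw [Finset.sum_eq_single (⟨k, hks⟩ : Fin s)]
      · have : s ≠ 0 := by omega
        simp [this]
      · intro i _ hi
        have h1 : ¬ ((k : ℕ) = i) := fun h => hi (Fin.ext h.symm)
        have h2 : ¬ ((k : ℕ) = s + i) := by omega
        simp [h1, h2]
      · simp
    · rw [Finset.sum_eq_single (⟨k - s, by omega⟩ : Fin s)]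
      · have h1 : ¬ ((k : ℕ) = k - s) := by omega
        have h2 : (k : ℕ) = s + (k - s) := by omega
        simp only [if_neg h1, if_pos h2]
        rw [← h2]
        ring
      · intro i _ hi
        have h1 : ¬ ((k : ℕ) = i) := by omega
        have h2 : ¬ ((k : ℕ) = s + i) := fun h => hi (Fin.ext (by simp; omega))
        simp [h1, h2]
      · simp
  have hD : D k l = M k.succ l.succ - M k.castSucc l.castSucc := by
    simp only [D, dif_pos (And.intro hk hl)]
  rw [Matrix.sub_apply, Matrix.sub_apply]
  linear_combination -(hsum.trans hD)

/-- The flip matrix, with ones on the antidiagonal. -/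
def flipMatrix (n : ℕ) : Matrix (Fin n) (Fin n) ℂ :=
  Matrix.of fun i j => if i = Fin.rev j then 1 else 0

theorem mul_flipMatrix_apply {n : ℕ} (A : Matrix (Fin n) (Fin n) ℂ) (i j : Fin n) :
    (A * flipMatrix n) i j = A i (Fin.rev j) := by
  simp [Matrix.mul_apply, flipMatrix]

theorem flipMatrix_mul_apply {n : ℕ} (A : Matrix (Fin n) (Fin n) ℂ) (i j : Fin n) :
    (flipMatrix n * A) i j = A (Fin.rev i) j := by
  have : ∀ k : Fin n, (i = Fin.rev k) ↔ (Fin.rev i = k) := fun k =>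
    ⟨fun h => by simp [h], fun h => by simp [← h]⟩
  simp [Matrix.mul_apply, flipMatrix, this]

theorem flipMatrix_mul_self (n : ℕ) : flipMatrix n * flipMatrix n = 1 := by
  ext i j
  rw [mul_flipMatrix_apply]
  simp [flipMatrix, Matrix.one_apply]

theorem flipMatrix_pow_mul_self (n r : ℕ) : flipMatrix n ^ r * flipMatrix n ^ r = 1 := by
  rw [← (Commute.refl (flipMatrix n)).mul_pow, flipMatrix_mul_self, one_pow]

theorem mul_flipMatrix_mem_hank {n : ℕ} {T : Matrix (Fin n) (Fin n) ℂ} (hT : T ∈ Toep n) :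
    T * flipMatrix n ∈ Hank n := by
  intro i j i' j' h
  rw [mul_flipMatrix_apply, mul_flipMatrix_apply]
  exact hT _ _ _ _ (by simp only [Fin.val_rev]; omega)

theorem flipMatrix_mul_mul_flipMatrix_mem_toep {n : ℕ} {T : Matrix (Fin n) (Fin n) ℂ}
    (hT : T ∈ Toep n) : flipMatrix n * T * flipMatrix n ∈ Toep n := by
  intro i j i' j' h
  rw [mul_flipMatrix_apply, mul_flipMatrix_apply, flipMatrix_mul_apply, flipMatrix_mul_apply]
  exact hT _ _ _ _ (by simp only [Fin.val_rev]; omega)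

theorem flipMatrix_mul_mul_flipMatrix_mem_toep_pow {n : ℕ} (r : ℕ) {T : Matrix (Fin n) (Fin n) ℂ}
    (hT : T ∈ (Toep n : Set (Matrix (Fin n) (Fin n) ℂ)) ^ r) :
    flipMatrix n * T * flipMatrix n ∈ (Toep n : Set (Matrix (Fin n) (Fin n) ℂ)) ^ r := by
  induction r generalizing T with
  | zero =>
    obtain rfl : T = 1 := by simpa using hT
    simp [flipMatrix_mul_self]
  | succ r ih =>
    rw [pow_succ] at hT ⊢
    obtain ⟨S, hS, T', hT', rfl⟩ := Set.mem_mul.1 hT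
    have : flipMatrix n * (S * T') * flipMatrix n =
        (flipMatrix n * S * flipMatrix n) * (flipMatrix n * T' * flipMatrix n) := by
      simp only [← mul_assoc, mul_assoc _ (flipMatrix n) (flipMatrix n), flipMatrix_mul_self,
        mul_one]
    rw [this]
    exact Set.mul_mem_mul (ih hS) (flipMatrix_mul_mul_flipMatrix_mem_toep hT')

/-- A product `T₁ ⋯ T_r J ^ r` with Toeplitz factors `T_i` and the flip matrix `J` is a product of
`r` Hankel matrices: move `J` to the left by `T J = J (J T J)`, where `J T J` is Toeplitz, and use
that `T J` is Hankel. -/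
theorem mul_flipMatrix_pow_mem_hank_pow {n : ℕ} (r : ℕ) {T : Matrix (Fin n) (Fin n) ℂ}
    (hT : T ∈ (Toep n : Set (Matrix (Fin n) (Fin n) ℂ)) ^ r) :
    T * flipMatrix n ^ r ∈ (Hank n : Set (Matrix (Fin n) (Fin n) ℂ)) ^ r := by
  induction r generalizing T with
  | zero => simpa using hT
  | succ r ih =>
    rw [pow_succ'] at hT
    obtain ⟨S, hS, T', hT', rfl⟩ := Set.mem_mul.1 hT
    have : S * T' * flipMatrix n ^ (r + 1) =
        (S * flipMatrix n) * ((flipMatrix n * T' * flipMatrix n) * flipMatrix n ^ r) := by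
      rw [pow_succ']
      simp only [← mul_assoc]
      rw [mul_assoc S (flipMatrix n) (flipMatrix n), flipMatrix_mul_self, mul_one]
    rw [this, pow_succ']
    exact Set.mul_mem_mul (mul_flipMatrix_mem_hank hS)
      (ih (flipMatrix_mul_mul_flipMatrix_mem_toep_pow r hT'))

theorem range_hankProd (n r : ℕ) :
    Set.range (hankProd n r) = (Hank n : Set (Matrix (Fin n) (Fin n) ℂ)) ^ r := by
  ext A
  rw [Set.mem_pow]
  rfl

open scoped Matrix.Norms.Operator in
/-- For `r ≥ ⌊n / 2⌋ + 1`, the products of `r` Toeplitz matrices contain infinitely many points of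
each line through a suitable matrix `a`. The operator norm is only used in the proof. -/
theorem exists_forall_infinite_add_smul_mem_toep_pow {n r : ℕ} (hr : n / 2 + 1 ≤ r) :
    ∃ a : Matrix (Fin n) (Fin n) ℂ, ∀ b : Matrix (Fin n) (Fin n) ℂ,
      {t : ℂ | a + t • b ∈ (Toep n : Set (Matrix (Fin n) (Fin n) ℂ)) ^ r}.Infinite := by
  obtain ⟨a, ha⟩ : ∃ a : Matrix (Fin n) (Fin n) ℂ, ∀ b : Matrix (Fin n) (Fin n) ℂ,
      {t : ℂ | a + t • b ∈ (Toep n : Set (Matrix (Fin n) (Fin n) ℂ)) ^ (n / 2 + 1)}.Infinite := by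
    cases n with
    | zero =>
      exact exists_forall_infinite_add_smul_mem_pow (s := 0) (Toep 0) (one_mem_toep 0) Fin.elim0
        (fun i => i.elim0) fun M => ⟨0, fun i => i.elim0, fun i => i.elim0⟩
    | succ m =>
      exact exists_forall_infinite_add_smul_mem_pow (Toep (m + 1)) (one_mem_toep _) (toepGen m)
        (toepGen_mem_toep m) (exists_sub_sum_toepGen_mul_mem_toep m)
  exact ⟨a, fun b => (ha b).mono fun t ht => Set.pow_subset_pow_right (one_mem_toep n) hr ht⟩

theorem exists_forall_infinite_add_smul_mem_hank_pow {n r : ℕ} (hr : n / 2 + 1 ≤ r) :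
    ∃ a : Matrix (Fin n) (Fin n) ℂ, ∀ b : Matrix (Fin n) (Fin n) ℂ,
      {t : ℂ | a + t • b ∈ (Hank n : Set (Matrix (Fin n) (Fin n) ℂ)) ^ r}.Infinite := by
  obtain ⟨a, ha⟩ := exists_forall_infinite_add_smul_mem_toep_pow hr
  refine ⟨a * flipMatrix n ^ r, fun b => (ha (b * flipMatrix n ^ r)).mono fun t ht => ?_⟩
  have := mul_flipMatrix_pow_mem_hank_pow r ht
  rwa [add_mul, smul_mul_assoc, mul_assoc b, flipMatrix_pow_mul_self, mul_one] at this

end ToeplitzHankel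

/-! ### Zariski density and generic points -/

section Zariski

theorem isClosed_zariskiTopology_zeroLocus {σ : Type} (I : Ideal (MvPolynomial σ ℂ)) :
    @IsClosed _ (zariskiTopology σ) (zeroLocus ℂ I) :=
  let _ := zariskiTopology σ
  ⟨⟨I, compl_compl _⟩⟩

theorem exists_eq_zeroLocus_of_isClosed {σ : Type} {Z : Set (σ → ℂ)}
    (hZ : @IsClosed _ (zariskiTopology σ) Z) :
    ∃ I : Ideal (MvPolynomial σ ℂ), Z = zeroLocus ℂ I := by
  let _ := zariskiTopology σ
  obtain ⟨I, hI⟩ := hZ.isOpen_compl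
  exact ⟨I, (compl_compl Z).symm.trans hI⟩

/-- A set is Zariski dense if every polynomial vanishing on it vanishes identically. -/
theorem closure_zariskiOn_eq_univ {X σ : Type} (c : X → σ → ℂ) {S : Set X}
    (h : ∀ p : MvPolynomial σ ℂ, (∀ x ∈ S, eval (c x) p = 0) → ∀ x, eval (c x) p = 0) :
    @closure X (zariskiOn c) S = Set.univ := by
  let _ := zariskiOn c
  refine Set.eq_univ_of_forall fun x => ?_
  rw [closure, Set.mem_sInter]
  rintro Z ⟨hZ, hSZ⟩
  obtain ⟨W, hW, rfl⟩ := (@isClosed_induced_iff _ _ (zariskiTopology σ) _ _).1 hZ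
  obtain ⟨I, rfl⟩ := exists_eq_zeroLocus_of_isClosed hW
  exact fun p hp => h p (fun y hy => hSZ hy p hp) x

/-- A property holds generically if it holds where some polynomial that is not identically zero
does not vanish. -/
theorem holdsGenerically_of_eval_ne_zero {X σ : Type} (c : X → σ → ℂ) {P : X → Prop}
    (g : MvPolynomial σ ℂ) (hg : ∃ x, eval (c x) g ≠ 0) (h : ∀ x, eval (c x) g ≠ 0 → P x) :
    HoldsGenerically c P := by
  let _ := zariskiOn c
  obtain ⟨x, hx⟩ := hg
  have hcl : IsClosed {x | eval (c x) g = 0} := by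
    refine (@isClosed_induced_iff _ _ (zariskiTopology σ) _ _).2
      ⟨zeroLocus ℂ (Ideal.span {g}), isClosed_zariskiTopology_zeroLocus _, ?_⟩
    ext
    simp [zeroLocus_span]
  have hsub : closure {x | ¬ P x} ⊆ {x | eval (c x) g = 0} :=
    closure_minimal (fun y hy => by_contra fun hne => hy (h y hne)) hcl
  intro huniv
  exact hx (hsub (huniv ▸ Set.mem_univ x))

/-- A polynomial vanishes identically if it has infinitely many zeros on each line through some
point. -/
theorem MvPolynomial.eq_zero_of_infinite_eval_add_smul {σ : Type*} {K : Type*} [Field K]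
    [Infinite K] (p : MvPolynomial σ K) (a : σ → K)
    (h : ∀ b : σ → K, {t : K | eval (a + t • b) p = 0}.Infinite) : p = 0 := by
  refine MvPolynomial.funext fun x => ?_
  let q : Polynomial K :=
    aeval (fun s => Polynomial.C (a s) + Polynomial.X * Polynomial.C ((x - a) s)) p
  have hq : ∀ t, q.eval t = eval (a + t • (x - a)) p := fun t => by
    rw [← Polynomial.coe_evalRingHom]
    simp only [q, aeval_def, hom_eval₂]
    rw [← eval₂_id]
    congr 1
    · ext; simp
    · ext s; simp
  have hq0 : q = 0 := Polynomial.eq_zero_of_infinite_isRoot q <| by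
    simpa [Polynomial.IsRoot, hq] using h (x - a)
  have := hq 1
  simpa [hq0] using this.symm

/-- The generic part of Chevalley's theorem: the image of a polynomial map between affine spaces
whose comorphism is injective contains the nonvanishing locus of a nonzero polynomial. -/
theorem exists_ne_zero_forall_eval_ne_zero_exists_eq {K σ τ : Type} [Field K] [IsAlgClosed K]
    [Finite σ] [Finite τ] (P : τ → MvPolynomial σ K)
    (hP : Function.Injective (aeval P : MvPolynomial τ K →ₐ[K] MvPolynomial σ K)) :
    ∃ g : MvPolynomial τ K, g ≠ 0 ∧
      ∀ y : τ → K, eval y g ≠ 0 → ∃ x : σ → K, ∀ t, y t = eval x (P t) := by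
  set φ : MvPolynomial τ K →+* MvPolynomial σ K := (aeval P).toRingHom with hφ
  have hfin : φ.FinitePresentation := by
    rw [← RingHom.FinitePresentation.of_finiteType]
    refine RingHom.FiniteType.of_comp_finiteType (f := C) ?_
    rw [show φ.comp C = C from (aeval P).comp_algebraMap]
    exact RingHom.finiteType_algebraMap.2 inferInstance
  obtain ⟨S, hS⟩ := PrimeSpectrum.exists_constructibleSetData_iff.2
    (PrimeSpectrum.isConstructible_range_comap hfin)
  -- the generic point is in the image, hence in one of the pieces `V(g₁, …) \ V(f)`
  have hbot : (⊥ : PrimeSpectrum (MvPolynomial τ K)) ∈ S.toSet := by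
    rw [hS]
    refine ⟨⊥, PrimeSpectrum.ext ?_⟩
    exact (RingHom.ker_eq_comap_bot φ).symm.trans ((RingHom.injective_iff_ker_eq_bot φ).1 hP)
  simp only [PrimeSpectrum.ConstructibleSetData.toSet, Set.mem_iUnion] at hbot
  obtain ⟨C, hC, hCg, hCf⟩ := hbot
  have hg0 : ∀ i, C.g i = 0 := fun i => by
    have := hCg ⟨i, rfl⟩
    simpa using this
  refine ⟨C.f, fun h => hCf (by simp [h]), fun y hy => ?_⟩
  let 𝔪 : PrimeSpectrum (MvPolynomial τ K) := ⟨vanishingIdeal K {y}, inferInstance⟩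
  have hm : 𝔪 ∈ Set.range (PrimeSpectrum.comap φ) := by
    rw [← hS]
    refine Set.mem_iUnion₂.2 ⟨C, hC, ?_, ?_⟩
    · rintro _ ⟨i, rfl⟩
      simp [hg0 i]
    · intro h
      have : C.f ∈ vanishingIdeal K {y} := h rfl
      rw [mem_vanishingIdeal_singleton_iff] at this
      exact hy (by simpa using this)
  obtain ⟨q, hq⟩ := hm
  obtain ⟨M, hM, hqM⟩ := Ideal.exists_le_maximal q.asIdeal q.2.ne_top
  obtain ⟨x, rfl⟩ := isMaximal_iff_eq_vanishingIdeal_singleton.1 hM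
  refine ⟨x, fun t => ?_⟩
  have h1 : (X t - MvPolynomial.C (y t) : MvPolynomial τ K) ∈ 𝔪.asIdeal := by
    change _ ∈ vanishingIdeal K {y}
    rw [mem_vanishingIdeal_singleton_iff]
    simp
  rw [← hq] at h1
  have h2 := hqM h1
  rw [mem_vanishingIdeal_singleton_iff] at h2
  have h3 : eval x (P t) - y t = 0 := by
    simpa [hφ] using h2
  exact (sub_eq_zero.1 h3).symm

end Zariski

/-! ### The product map on tuples of Hankel matrices -/

theorem mapMatrix_list_ofFn_prod {R S : Type*} [CommSemiring R] [CommSemiring S] (f : R →+* S)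
    {n r : ℕ} (G : Fin r → Matrix (Fin n) (Fin n) R) (i j : Fin n) :
    f ((List.ofFn G).prod i j) = (List.ofFn fun k => (G k).map f).prod i j := by
  have := congrArg (fun M : Matrix (Fin n) (Fin n) S => M i j)
    (map_list_prod f.mapMatrix (List.ofFn G))
  simpa [List.map_ofFn, Function.comp_def] using this

theorem isMorphism_hankProd (n r : ℕ) :
    IsMorphism (hankTupleCoords n r) (matrixCoords n) (hankProd n r) := by
  refine ⟨fun t => (List.ofFn fun k : Fin r =>
    (Matrix.of fun i j : Fin n => (X (k, i, j) : MvPolynomial (Fin r × Fin n × Fin n) ℂ))).prod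
      t.1 t.2, fun H t => ?_⟩
  rw [mapMatrix_list_ofFn_prod]
  have : ∀ k : Fin r, (Matrix.of fun i j : Fin n =>
      (X (k, i, j) : MvPolynomial (Fin r × Fin n × Fin n) ℂ)).map
        (eval (hankTupleCoords n r H)) = H k := fun k => by
    ext i j
    simp [hankTupleCoords]
  simp only [this]
  rfl

/-- A nonzero polynomial does not vanish on all products of `r` Hankel matrices. -/
theorem eq_zero_of_forall_mem_range_hankProd {n r : ℕ} (hr : n / 2 + 1 ≤ r)
    (p : MvPolynomial (Fin n × Fin n) ℂ)
    (hp : ∀ A ∈ Set.range (hankProd n r), eval (matrixCoords n A) p = 0) : p = 0 := by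
  obtain ⟨a, ha⟩ := exists_forall_infinite_add_smul_mem_hank_pow hr
  refine p.eq_zero_of_infinite_eval_add_smul (matrixCoords n a) fun b =>
    (ha (Matrix.of fun i j => b (i, j))).mono fun t ht => ?_
  rw [← range_hankProd] at ht
  have h := hp _ ht
  have hc : matrixCoords n (a + t • Matrix.of fun i j => b (i, j)) =
      matrixCoords n a + t • b := by
    ext
    simp [matrixCoords]
  rwa [hc] at h

/-- The Hankel matrix `(x (i + j))` with entries in an arbitrary type. The sequence `x` is indexed
by `Fin (2 * n)` rather than `Fin (2 * n - 1)`; its last term is not used. -/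
def hankelMatrix {R : Type*} {n : ℕ} (x : Fin (2 * n) → R) : Matrix (Fin n) (Fin n) R :=
  Matrix.of fun i j => x ⟨i + j, by omega⟩

theorem hankelMatrix_mem_hank {n : ℕ} (x : Fin (2 * n) → ℂ) : hankelMatrix x ∈ Hank n :=
  fun i j i' j' h => by simp [hankelMatrix, h]

theorem exists_eq_hankelMatrix {n : ℕ} {H : Matrix (Fin n) (Fin n) ℂ} (hH : H ∈ Hank n) :
    ∃ x : Fin (2 * n) → ℂ, H = hankelMatrix x := by
  classical
  refine ⟨fun d => if h : ∃ q : Fin n × Fin n, (q.1 : ℕ) + q.2 = d then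
    H h.choose.1 h.choose.2 else 0, ?_⟩
  ext i j
  have h : ∃ q : Fin n × Fin n, (q.1 : ℕ) + q.2 = i + j := ⟨(i, j), rfl⟩
  simp only [hankelMatrix, Matrix.of_apply, dif_pos h]
  exact hH _ _ _ _ h.choose_spec.symm

/-- The entries of the product of `r` generic Hankel matrices, whose entries are variables. -/
noncomputable def genericHankelProd (n r : ℕ) (t : Fin n × Fin n) :
    MvPolynomial (Fin r × Fin (2 * n)) ℂ :=
  (List.ofFn fun k : Fin r => hankelMatrix fun d =>
    (X (k, d) : MvPolynomial (Fin r × Fin (2 * n)) ℂ)).prod t.1 t.2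

theorem eval_genericHankelProd {n r : ℕ} (x : Fin r × Fin (2 * n) → ℂ) (t : Fin n × Fin n) :
    eval x (genericHankelProd n r t) =
      (List.ofFn fun k : Fin r => hankelMatrix fun d => x (k, d)).prod t.1 t.2 := by
  rw [genericHankelProd, mapMatrix_list_ofFn_prod]
  have : ∀ k : Fin r, (hankelMatrix fun d =>
      (X (k, d) : MvPolynomial (Fin r × Fin (2 * n)) ℂ)).map (eval x) =
        hankelMatrix fun d => x (k, d) := fun k => by
    ext i j
    simp [hankelMatrix]
  simp only [this]

theorem aeval_genericHankelProd_injective {n r : ℕ} (hr : n / 2 + 1 ≤ r) :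
    Function.Injective (aeval (genericHankelProd n r) :
      MvPolynomial (Fin n × Fin n) ℂ →ₐ[ℂ] MvPolynomial (Fin r × Fin (2 * n)) ℂ) := by
  rw [injective_iff_map_eq_zero]
  intro p hp
  refine eq_zero_of_forall_mem_range_hankProd hr p ?_
  rintro _ ⟨H, rfl⟩
  choose x hx using fun k => exists_eq_hankelMatrix (H k).2
  have h := congrArg (aeval fun q : Fin r × Fin (2 * n) => x q.1 q.2) hp
  rw [comp_aeval_apply, map_zero] at h
  simp only [aeval_eq_eval, eval_genericHankelProd] at h
  convert h using 3
  ext t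
  simp only [matrixCoords, hankProd, hx]

theorem mainTheorem2 (n : ℕ) :
    (∀ r : ℕ, n / 2 + 1 ≤ r →
      IsDominantMorphism (hankTupleCoords n r) (matrixCoords n) (hankProd n r)) ∧
    HoldsGenerically (matrixCoords n)
      (fun A => ∃ H : Fin (n / 2 + 1) → Hank n, A = hankProd n (n / 2 + 1) H) := by
  refine ⟨fun r hr => ⟨isMorphism_hankProd n r, closure_zariskiOn_eq_univ _ fun p hp A => ?_⟩, ?_⟩
  · rw [eq_zero_of_forall_mem_range_hankProd hr p hp, map_zero]
  obtain ⟨g, hg, hgP⟩ := exists_ne_zero_forall_eval_ne_zero_exists_eq _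
    (aeval_genericHankelProd_injective (n := n) le_rfl)
  refine holdsGenerically_of_eval_ne_zero _ g ?_ fun A hA => ?_
  · by_contra! hcon
    refine hg (MvPolynomial.funext fun y => ?_)
    rw [map_zero]
    exact hcon (Matrix.of fun i j => y (i, j))
  · obtain ⟨x, hx⟩ := hgP _ hA
    refine ⟨fun k => ⟨hankelMatrix fun d => x (k, d), hankelMatrix_mem_hank _⟩, ?_⟩
    ext i j
    exact (hx (i, j)).trans (eval_genericHankelProd x (i, j))
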